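/- A bipartite degree sequence $\boldsymbol d$ assigns a non-negative integer to every vertex of two disjoint finite labelled colour classes $A$ and $B$. Its realizations are the simple bipartite graphs with colour classes $A$ and $B$ (every edge joins $A$ to $B$) in which every vertex has the prescribed degree; $\mathcal G(\boldsymbol d)$ is the set of realizations, and $\boldsymbol d$ is graphic if $\mathcal G(\boldsymbol d)\neq\emptyset$. A class $\mathcal D$ of graphic bipartite degree sequences is $P$-stable if there is a polynomial $p\in\mathbb R[x]$ such that for every $\boldsymbol d\in\mathcal D$, with $N=|A|+|B|$ vertices, and every bipartite degree sequence $\boldsymbol d'$ on the same colour classes with $\|\boldsymbol d'-\boldsymbol d\|_1\le 2$ we have $|\mathcal G(\boldsymbol d')|\le p(N)\cdot|\mathcal G(\boldsymbol d)|$. For $n\ge 1$ let $\boldsymbol h_0(n)$ be the bipartite degree sequence on $A=\{a_1,\dots,a_n\}$ and $B=\{b_1,\dots,b_n\}$ with $\deg(a_i)=n+1-i$ and $\deg(b_i)=i$ for $1\le i\le n$. For integers $0\le k\le n$ with $n\ge1$ let $\boldsymbol h_k(n)=\boldsymbol h_0(n)-k\cdot\mathbb 1_{a_1}-k\cdot\mathbb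 1_{b_n}$, where $\mathbb 1_x$ is $1$ at $x$ and $0$ elsewhere, and let $\mathcal H_k=\{\boldsymbol h_k(n) : n\ge 1,\ n\ge k\}$. Theorem. For every integer $k\ge 0$, every member of $\mathcal H_k$ is graphic, and the class $\mathcal H_k$ is not $P$-stable. -/

import Mathlib

/-- A bipartite degree sequence: the colour classes are `A = {a_1, …, a_m}` (the summand `Fin m`) and
`B = {b_1, …, b_n}` (the summand `Fin n`), both labelled from `0` in the code, and
`deg` prescribes a degree for every vertex. It need not be graphic. -/
structure BipDegSeq where
  m : ℕ
  n : ℕ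
  deg : Fin m ⊕ Fin n → ℕ

/-- The set of (labelled) realizations of a degree function on the classes `A = Fin m`, `B = Fin n`:
simple graphs all of whose edges join `A` to `B`, with the prescribed degrees. -/
def bipRealizations {m n : ℕ} (d : Fin m ⊕ Fin n → ℕ) : Set (SimpleGraph (Fin m ⊕ Fin n)) :=
  {G | G.IsBipartiteWith (Set.range Sum.inl) (Set.range Sum.inr) ∧
    ∀ v, (G.neighborSet v).ncard = d v}

/-- A degree sequence is graphic if it has a realization. -/
def BipDegSeq.IsGraphic (d : BipDegSeq) : Prop :=
  (bipRealizations d.deg).Nonempty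

/-- `k`-stability: some polynomial `p`, evaluated at the number of vertices, bounds
`|𝒢(d')| / |𝒢(d)|` for all `d ∈ D` and all `d'` on the same vertices with `‖d' - d‖₁ ≤ k`. -/
def IsStableClass (k : ℕ) (D : Set BipDegSeq) : Prop :=
  ∃ p : Polynomial ℝ, ∀ d ∈ D, ∀ d' : Fin d.m ⊕ Fin d.n → ℕ,
    ∑ v, |(d' v : ℤ) - (d.deg v : ℤ)| ≤ (k : ℤ) →
      ((bipRealizations d').ncard : ℝ) ≤
        p.eval ((d.m + d.n : ℕ) : ℝ) * ((bipRealizations d.deg).ncard : ℝ)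

/-- `P`-stability is `2`-stability. -/
def IsPStable (D : Set BipDegSeq) : Prop :=
  IsStableClass 2 D

/-- `h_0(n)`: `deg(a_i) = n + 1 - i` and `deg(b_i) = i` for `1 ≤ i ≤ n`. -/
def halfGraphDeg (n : ℕ) : Fin n ⊕ Fin n → ℕ :=
  Sum.elim (fun i => n - (i : ℕ)) (fun j => (j : ℕ) + 1)

/-- `h_k(n) = h_0(n) - k·1_{a_1} - k·1_{b_n}`. It is used for `k ≤ n` only, and then the
subtraction of natural numbers is exact, because `h_0(n)` is `n` at `a_1` and at `b_n`. -/
def hDeg (k n : ℕ) : Fin n ⊕ Fin n → ℕ :=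
  Sum.elim (fun i => halfGraphDeg n (Sum.inl i) - if (i : ℕ) = 0 then k else 0)
    (fun j => halfGraphDeg n (Sum.inr j) - if (j : ℕ) + 1 = n then k else 0)

/-- `h_k(n)` as a bipartite degree sequence. -/
abbrev hSeq (k n : ℕ) : BipDegSeq where
  m := n
  n := n
  deg := hDeg k n

/-- The class `ℋ_k` of all `h_k(n)` with `n ≥ 1` and `n ≥ k`. -/
def hClass (k : ℕ) : Set BipDegSeq :=
  {d | ∃ n : ℕ, 1 ≤ n ∧ k ≤ n ∧ d = hSeq k n}

/-! The half graph, with `a_i` adjacent to `b_j` iff `i ≤ j`, realizes `h_0(n)`. Place the vertices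
in the order `a_1, b_1, a_2, b_2, …` and record each pair where a realization of `h_k(n)` differs
from the half graph as an arc: a lost edge points from `A` to `B`, a gained one from `B` to `A`. All
arcs increase, and the degree conditions say precisely that they form a unit-capacity flow of value
`k` from `a_1` to `b_n` (`ncard_bipRealizations_hDeg`).

Let `f_k(N)` count the flows of value `k` from `0` to `2N + 1`. Stripping off `k` paths gives
`f_k(N) ≤ 4^(k(N+1))` (`card_flows_le`). Conversely, threading a new path through `m` fresh pairs of
vertices gives `C(N,m) f_k(N-m) ≤ (2N+2) f_{k+1}(N)` (`choose_mul_card_flows_le`). If `f_{k+1} ≤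
poly · f_k` with degree `d`, then `m = d + 2` makes `f_k(N+m) / f_k(N)` at least linear in `N`,
against the exponential bound. As `h_{k+1}(n)` is at distance at most `2` from `h_k(n)`, stability
fails. -/

/-! ### Unit-capacity flows -/

open Finset in
/-- Number of arcs of `E` leaving `v`. -/
def outDeg (E : Finset (ℕ × ℕ)) (v : ℕ) : ℕ := #{e ∈ E | e.1 = v}

open Finset in
/-- Number of arcs of `E` entering `v`. -/
def inDeg (E : Finset (ℕ × ℕ)) (v : ℕ) : ℕ := #{e ∈ E | e.2 = v}

/-- `E` is a flow with unit capacities and value `k` from `0` to `L` along increasing arcs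
joining vertices of opposite parity. -/
structure IsFlow (L k : ℕ) (E : Finset (ℕ × ℕ)) : Prop where
  arc : ∀ e ∈ E, e.1 < e.2 ∧ e.2 ≤ L ∧ (e.1 + e.2) % 2 = 1
  balance : ∀ v, outDeg E v + (if v = L then k else 0) = inDeg E v + (if v = 0 then k else 0)

open Classical in
/-- All flows of value `k` from `0` to `L`. -/
noncomputable def flows (L k : ℕ) : Finset (Finset (ℕ × ℕ)) :=
  {E ∈ (Finset.range (L + 1) ×ˢ Finset.range (L + 1)).powerset | IsFlow L k E}

theorem mem_flows {L k : ℕ} {E : Finset (ℕ × ℕ)} : E ∈ flows L k ↔ IsFlow L k E := by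
  simp only [flows, Finset.mem_filter, Finset.mem_powerset, and_iff_right_iff_imp]
  intro h e he
  have := h.arc e he
  simp only [Finset.mem_product, Finset.mem_range]
  omega

theorem outDeg_union {E F : Finset (ℕ × ℕ)} (h : Disjoint E F) (v : ℕ) :
    outDeg (E ∪ F) v = outDeg E v + outDeg F v := by
  simp only [outDeg, Finset.filter_union]
  exact Finset.card_union_of_disjoint (Finset.disjoint_filter_filter h)

theorem inDeg_union {E F : Finset (ℕ × ℕ)} (h : Disjoint E F) (v : ℕ) :
    inDeg (E ∪ F) v = inDeg E v + inDeg F v := by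
  simp only [inDeg, Finset.filter_union]
  exact Finset.card_union_of_disjoint (Finset.disjoint_filter_filter h)

theorem IsFlow.union {L k l : ℕ} {E F : Finset (ℕ × ℕ)} (hE : IsFlow L k E) (hF : IsFlow L l F)
    (h : Disjoint E F) : IsFlow L (k + l) (E ∪ F) := by
  refine ⟨fun e he => (Finset.mem_union.1 he).elim (hE.arc e) (hF.arc e), fun v => ?_⟩
  have h1 := hE.balance v
  have h2 := hF.balance v
  rw [outDeg_union h, inDeg_union h]
  split_ifs at * <;> omega

theorem IsFlow.sdiff {L k l : ℕ} {E F : Finset (ℕ × ℕ)} (hE : IsFlow L (k + l) E)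
    (hF : IsFlow L l F) (h : F ⊆ E) : IsFlow L k (E \ F) := by
  refine ⟨fun e he => hE.arc e (Finset.mem_sdiff.1 he).1, fun v => ?_⟩
  have h1 := hE.balance v
  have h2 := hF.balance v
  have hd : Disjoint (E \ F) F := Finset.sdiff_disjoint
  have h3 := outDeg_union hd v
  have h4 := inDeg_union hd v
  rw [Finset.sdiff_union_of_subset h] at h3 h4
  split_ifs at * <;> omega

/-! ### Increasing paths as flows of value one -/

/-- The pairs of consecutive elements of `V`: the path that visits `V` in increasing order. -/
def consec (V : Finset ℕ) : Finset (ℕ × ℕ) :=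
  {e ∈ V ×ˢ V | e.1 < e.2 ∧ ∀ w ∈ V, w ≤ e.1 ∨ e.2 ≤ w}

theorem mem_consec {V : Finset ℕ} {u v : ℕ} :
    (u, v) ∈ consec V ↔ u ∈ V ∧ v ∈ V ∧ u < v ∧ ∀ w ∈ V, w ≤ u ∨ v ≤ w := by
  simp [consec, and_assoc]

theorem consec_right_unique {V : Finset ℕ} {u v w : ℕ} (hv : (u, v) ∈ consec V)
    (hw : (u, w) ∈ consec V) : v = w := by
  rw [mem_consec] at hv hw
  have h1 := hv.2.2.2 w hw.2.1
  have h2 := hw.2.2.2 v hv.2.1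
  omega

theorem consec_left_unique {V : Finset ℕ} {u v w : ℕ} (hv : (u, w) ∈ consec V)
    (hw : (v, w) ∈ consec V) : u = v := by
  rw [mem_consec] at hv hw
  have h1 := hv.2.2.2 v hw.1
  have h2 := hw.2.2.2 u hv.1
  omega

theorem exists_consec_right {V : Finset ℕ} {u w : ℕ} (hu : u ∈ V) (hw : w ∈ V) (h : u < w) :
    ∃ v, (u, v) ∈ consec V := by
  have hne : (V.filter (u < ·)).Nonempty := ⟨w, by simp [hw, h]⟩
  have hm := Finset.min'_mem _ hne
  rw [Finset.mem_filter] at hm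
  refine ⟨_, mem_consec.2 ⟨hu, hm.1, hm.2, fun x hx => ?_⟩⟩
  by_contra! hc
  exact absurd (Finset.min'_le _ x (by simp [hx, hc.1])) (not_le.2 hc.2)

theorem exists_consec_left {V : Finset ℕ} {u w : ℕ} (hu : u ∈ V) (hw : w ∈ V) (h : w < u) :
    ∃ v, (v, u) ∈ consec V := by
  have hne : (V.filter (· < u)).Nonempty := ⟨w, by simp [hw, h]⟩
  have hm := Finset.max'_mem _ hne
  rw [Finset.mem_filter] at hm
  refine ⟨_, mem_consec.2 ⟨hm.1, hu, hm.2, fun x hx => ?_⟩⟩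
  by_contra! hc
  exact absurd (Finset.le_max' _ x (by simp [hx, hc.2])) (not_le.2 hc.1)

/-- Each element of `V` except the last has exactly one successor. The correction term copies the
one in `balance`, so conservation follows by comparison with `inDeg_consec`. -/
theorem outDeg_consec {V : Finset ℕ} {L : ℕ} (hL : L ∈ V) (hV : ∀ v ∈ V, v ≤ L) (v : ℕ) :
    outDeg (consec V) v + (if v = L then 1 else 0) = if v ∈ V then 1 else 0 := by
  by_cases hv : v ∈ V ∧ v < L
  · obtain ⟨w, hw⟩ := exists_consec_right hv.1 hL hv.2
    have : (consec V).filter (fun e => e.1 = v) = {(v, w)} := by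
      ext ⟨a, b⟩
      simp only [Finset.mem_filter, Finset.mem_singleton, Prod.mk.injEq]
      constructor
      · rintro ⟨h, rfl⟩
        exact ⟨rfl, consec_right_unique h hw⟩
      · rintro ⟨rfl, rfl⟩
        exact ⟨hw, rfl⟩
    simp [outDeg, this, hv.1, hv.2.ne]
  · have : (consec V).filter (fun e => e.1 = v) = ∅ := by
      refine Finset.filter_eq_empty_iff.2 ?_
      rintro ⟨a, b⟩ h rfl
      rw [mem_consec] at h
      exact hv ⟨h.1, h.2.2.1.trans_le (hV _ h.2.1)⟩
    by_cases hvL : v = L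
    · subst hvL; simp [outDeg, this, hL]
    · have : v ∉ V := fun h => hv ⟨h, lt_of_le_of_ne (hV v h) hvL⟩
      simp [outDeg, *]

theorem inDeg_consec {V : Finset ℕ} (h0 : 0 ∈ V) (v : ℕ) :
    inDeg (consec V) v + (if v = 0 then 1 else 0) = if v ∈ V then 1 else 0 := by
  by_cases hv : v ∈ V ∧ 0 < v
  · obtain ⟨w, hw⟩ := exists_consec_left hv.1 h0 hv.2
    have : (consec V).filter (fun e => e.2 = v) = {(w, v)} := by
      ext ⟨a, b⟩
      simp only [Finset.mem_filter, Finset.mem_singleton, Prod.mk.injEq]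
      constructor
      · rintro ⟨h, rfl⟩
        exact ⟨consec_left_unique h hw, rfl⟩
      · rintro ⟨rfl, rfl⟩
        exact ⟨hw, rfl⟩
    simp [inDeg, this, hv.1, hv.2.ne']
  · have : (consec V).filter (fun e => e.2 = v) = ∅ := by
      refine Finset.filter_eq_empty_iff.2 ?_
      rintro ⟨a, b⟩ h rfl
      rw [mem_consec] at h
      exact hv ⟨h.2.1, h.2.2.1.pos⟩
    by_cases hv0 : v = 0
    · subst hv0; simp [inDeg, this, h0]
    · have : v ∉ V := fun h => hv ⟨h, Nat.pos_of_ne_zero hv0⟩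
      simp [inDeg, *]

theorem isFlow_consec {V : Finset ℕ} {L : ℕ} (h0 : 0 ∈ V) (hL : L ∈ V) (hV : ∀ v ∈ V, v ≤ L)
    (hpar : ∀ e ∈ consec V, (e.1 + e.2) % 2 = 1) : IsFlow L 1 (consec V) := by
  refine ⟨fun e he => ⟨?_, ?_, hpar e he⟩, fun v => ?_⟩
  · exact (mem_consec.1 he).2.2.1
  · exact hV _ (mem_consec.1 he).2.1
  · rw [outDeg_consec hL hV, inDeg_consec h0]

/-! ### Exponential upper bound by removing paths -/

/-- In a flow, every vertex that can be left or entered is the end of a path from `0`. -/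
theorem IsFlow.exists_consec_subset {L k : ℕ} {E : Finset (ℕ × ℕ)} (hE : IsFlow L k E) (v : ℕ)
    (hv : ∃ u, (u, v) ∈ E) :
    ∃ V : Finset ℕ, 0 ∈ V ∧ v ∈ V ∧ (∀ w ∈ V, w ≤ v) ∧ consec V ⊆ E := by
  induction v using Nat.strong_induction_on with
  | _ v ih =>
    obtain ⟨u, hu⟩ := hv
    have harc := hE.arc _ hu
    have key : ∃ V : Finset ℕ, 0 ∈ V ∧ u ∈ V ∧ (∀ w ∈ V, w ≤ u) ∧ consec V ⊆ E := by
      rcases Nat.eq_zero_or_pos u with rfl | hpos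
      · refine ⟨{0}, by simp, by simp, by simp, ?_⟩
        rintro ⟨a, b⟩ h
        rw [mem_consec] at h
        simp only [Finset.mem_singleton] at h
        omega
      -- `u` is neither source nor sink, so conservation turns the arc leaving it into an arc
      -- entering it.
      · refine ih u harc.1 ?_
        have hb := hE.balance u
        have hout : 0 < outDeg E u := Finset.card_pos.2 ⟨(u, v), by simp [hu]⟩
        rw [if_neg (by omega), if_neg (by omega)] at hb
        obtain ⟨⟨a, b⟩, hab⟩ := Finset.card_pos.1 (show 0 < inDeg E u by omega)
        rw [Finset.mem_filter] at hab
        obtain ⟨h1, rfl⟩ := hab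
        exact ⟨a, h1⟩
    obtain ⟨V, h0, huV, hle, hsub⟩ := key
    refine ⟨insert v V, by simp [h0], by simp, ?_, ?_⟩
    · intro w hw
      rcases Finset.mem_insert.1 hw with rfl | hw
      · exact le_rfl
      · exact (hle w hw).trans harc.1.le
    · rintro ⟨a, b⟩ h
      rw [mem_consec] at h
      obtain ⟨ha, hb, hab, hall⟩ := h
      have hlt : ∀ w ∈ V, w < v := fun w hw => (hle w hw).trans_lt harc.1
      rcases Finset.mem_insert.1 ha with rfl | ha'
      · rcases Finset.mem_insert.1 hb with rfl | hb
        · omega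
        · have := hlt b hb; omega
      · rcases Finset.mem_insert.1 hb with rfl | hb'
        · have h1 := hle a ha'
          have h2 := hall u (by simp [huV])
          have h3 := hlt u huV
          obtain rfl : a = u := by omega
          exact hu
        · exact hsub (mem_consec.2 ⟨ha', hb', hab, fun w hw => hall w (by simp [hw])⟩)

/-- A flow of positive value contains a path from `0` to `L`. The path is determined by its vertex
set, one of `2 ^ (L + 1)` subsets, and together with the remaining flow it gives back the original.
-/
theorem card_flows_succ_le {L : ℕ} (hL : 0 < L) (k : ℕ) :
    (flows L (k + 1)).card ≤ 2 ^ (L + 1) * (flows L k).card := by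
  have key : ∀ E ∈ flows L (k + 1), ∃ V ∈ (Finset.range (L + 1)).powerset,
      consec V ⊆ E ∧ E \ consec V ∈ flows L k := by
    intro E hE
    rw [mem_flows] at hE
    have hb := hE.balance L
    rw [if_pos rfl, if_neg (by omega)] at hb
    obtain ⟨⟨a, b⟩, hab⟩ := Finset.card_pos.1 (show 0 < inDeg E L by omega)
    rw [Finset.mem_filter] at hab
    obtain ⟨h1, rfl⟩ := hab
    obtain ⟨V, h0, hbV, hle, hsub⟩ := hE.exists_consec_subset b ⟨a, h1⟩
    refine ⟨V, ?_, hsub, ?_⟩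
    · rw [Finset.mem_powerset]
      intro w hw
      exact Finset.mem_range.2 (Nat.lt_succ_of_le (hle w hw))
    · rw [mem_flows]
      exact hE.sdiff (isFlow_consec h0 hbV hle fun e he => (hE.arc e (hsub he)).2.2) hsub
  choose! V hV hsub hflow using key
  have := Finset.card_le_card_of_injOn (s := flows L (k + 1))
    (t := (Finset.range (L + 1)).powerset ×ˢ flows L k) (fun E => (V E, E \ consec (V E)))
    (fun E hE => Finset.mem_coe.2 (Finset.mem_product.2 ⟨hV E hE, hflow E hE⟩)) (by
      intro E hE F hF h
      simp only [Prod.mk.injEq] at h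
      rw [← Finset.sdiff_union_of_subset (hsub E hE), ← Finset.sdiff_union_of_subset (hsub F hF),
        h.2, h.1])
  simpa [Finset.card_product, Finset.card_powerset] using this

/-- With value `0` every arc has a preceding arc, which is impossible in an acyclic network. -/
theorem IsFlow.eq_empty {L : ℕ} {E : Finset (ℕ × ℕ)} (hE : IsFlow L 0 E) : E = ∅ := by
  have key : ∀ v u, (u, v) ∉ E := by
    intro v
    induction v using Nat.strong_induction_on with
    | _ v ih =>
      intro u hu
      have hb := hE.balance u
      have hout : 0 < outDeg E u := Finset.card_pos.2 ⟨(u, v), by simp [hu]⟩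
      simp only [ite_self, add_zero] at hb
      obtain ⟨⟨a, b⟩, hab⟩ := Finset.card_pos.1 (show 0 < inDeg E u by omega)
      rw [Finset.mem_filter] at hab
      obtain ⟨h1, rfl⟩ := hab
      exact ih b (hE.arc _ hu).1 a h1
  exact Finset.eq_empty_of_forall_notMem fun e => key e.2 e.1

theorem card_flows_le {L : ℕ} (hL : 0 < L) (k : ℕ) :
    (flows L k).card ≤ (2 ^ (L + 1)) ^ k := by
  induction k with
  | zero =>
    simp only [pow_zero]
    refine Finset.card_le_one.2 fun E hE F hF => ?_
    rw [(mem_flows.1 hE).eq_empty, (mem_flows.1 hF).eq_empty]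
  | succ k ih =>
    calc _ ≤ _ := card_flows_succ_le hL k
      _ ≤ 2 ^ (L + 1) * (2 ^ (L + 1)) ^ k := by gcongr
      _ = _ := by ring

/-! ### Making room for a new path -/

/-- The increasing enumeration of the numbers outside `S`. -/
noncomputable def skip (S : Finset ℕ) : ℕ → ℕ := Nat.nth (· ∉ S)

theorem skip_strictMono (S : Finset ℕ) : StrictMono (skip S) :=
  Nat.nth_strictMono S.finite_toSet.infinite_compl

theorem skip_notMem (S : Finset ℕ) (i : ℕ) : skip S i ∉ S :=
  Nat.nth_mem_of_infinite S.finite_toSet.infinite_compl i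

/-- Exactly `N - S.card` numbers below `N` avoid `S`, and `N` is the next one. -/
theorem skip_sub_card {S : Finset ℕ} {N : ℕ} (hS : S ⊆ Finset.range N) :
    skip S (N - S.card) = N := by
  classical
  have h : Nat.count (· ∉ S) N = N - S.card := by
    rw [Nat.count_eq_card_filter_range, Finset.filter_notMem_eq_sdiff,
      Finset.card_sdiff_of_subset hS, Finset.card_range]
  rw [← h]
  refine Nat.nth_count (p := (· ∉ S)) fun hN => ?_
  simpa using hS hN

/-- Relabelling of the vertices that leaves the vertices `2 s + 1` and `2 s + 2` free for `s ∈ S`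
and keeps the order and the parity. -/
noncomputable def relabel (S : Finset ℕ) (p : ℕ) : ℕ :=
  if p = 0 then 0 else 2 * skip S ((p - 1) / 2) + 1 + (p - 1) % 2

theorem relabel_zero (S : Finset ℕ) : relabel S 0 = 0 := by simp [relabel]

theorem relabel_strictMono (S : Finset ℕ) : StrictMono (relabel S) := by
  intro p q h
  unfold relabel
  rw [if_neg (show q ≠ 0 by omega)]
  split_ifs with hp
  · omega
  · rcases (show (p - 1) / 2 ≤ (q - 1) / 2 by omega).eq_or_lt with h1 | h1
    · rw [h1]; omega
    · have := skip_strictMono S h1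
      omega

theorem relabel_mod_two (S : Finset ℕ) (p : ℕ) : relabel S p % 2 = p % 2 := by
  unfold relabel
  split_ifs <;> omega

theorem relabel_last {S : Finset ℕ} {N : ℕ} (hS : S ⊆ Finset.range N) :
    relabel S (2 * (N - S.card) + 1) = 2 * N + 1 := by
  unfold relabel
  rw [if_neg (by omega), show (2 * (N - S.card) + 1 - 1) / 2 = N - S.card by omega,
    skip_sub_card hS]
  omega

theorem half_relabel_notMem (S : Finset ℕ) {p : ℕ} (hp : relabel S p ≠ 0) :
    (relabel S p - 1) / 2 ∉ S := by
  have h : p ≠ 0 := by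
    rintro rfl
    exact hp (relabel_zero S)
  rw [relabel, if_neg h, show (2 * skip S ((p - 1) / 2) + 1 + (p - 1) % 2 - 1) / 2 =
    skip S ((p - 1) / 2) by omega]
  exact skip_notMem S _

/-- The image of an arc set under a relabelling. -/
def mapArcs (f : ℕ → ℕ) (E : Finset (ℕ × ℕ)) : Finset (ℕ × ℕ) :=
  E.image (Prod.map f f)

theorem mapArcs_injective {f : ℕ → ℕ} (hf : Function.Injective f) :
    Function.Injective (mapArcs f) :=
  Finset.image_injective (hf.prodMap hf)

theorem outDeg_mapArcs {f : ℕ → ℕ} (hf : Function.Injective f) (E : Finset (ℕ × ℕ)) (v : ℕ) :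
    outDeg (mapArcs f E) (f v) = outDeg E v := by
  unfold outDeg mapArcs
  rw [Finset.filter_image, Finset.card_image_of_injective _ (hf.prodMap hf)]
  simp [hf.eq_iff]

theorem inDeg_mapArcs {f : ℕ → ℕ} (hf : Function.Injective f) (E : Finset (ℕ × ℕ)) (v : ℕ) :
    inDeg (mapArcs f E) (f v) = inDeg E v := by
  unfold inDeg mapArcs
  rw [Finset.filter_image, Finset.card_image_of_injective _ (hf.prodMap hf)]
  simp [hf.eq_iff]

theorem deg_mapArcs_of_notMem_range {f : ℕ → ℕ} (E : Finset (ℕ × ℕ)) {v : ℕ}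
    (hv : v ∉ Set.range f) : outDeg (mapArcs f E) v = 0 ∧ inDeg (mapArcs f E) v = 0 := by
  unfold outDeg inDeg mapArcs
  simp only [Finset.card_eq_zero, Finset.filter_eq_empty_iff, Finset.mem_image]
  constructor
  · rintro _ ⟨e, -, rfl⟩ rfl
    exact hv ⟨e.1, rfl⟩
  · rintro _ ⟨e, -, rfl⟩ rfl
    exact hv ⟨e.2, rfl⟩

theorem IsFlow.mapArcs_relabel {S : Finset ℕ} {N k : ℕ} (hS : S ⊆ Finset.range N)
    {E : Finset (ℕ × ℕ)} (hE : IsFlow (2 * (N - S.card) + 1) k E) :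
    IsFlow (2 * N + 1) k (mapArcs (relabel S) E) := by
  have hm := relabel_strictMono S
  constructor
  · intro e he
    obtain ⟨e, he', rfl⟩ := Finset.mem_image.1 he
    obtain ⟨h1, h2, h3⟩ := hE.arc e he'
    refine ⟨hm h1, ?_, ?_⟩
    · rw [← relabel_last hS]
      exact hm.monotone h2
    · have h4 := relabel_mod_two S e.1
      have h5 := relabel_mod_two S e.2
      simp only [Prod.map_fst, Prod.map_snd]
      omega
  · intro v
    by_cases hv : v ∈ Set.range (relabel S)
    · obtain ⟨u, rfl⟩ := hv
      rw [outDeg_mapArcs hm.injective, inDeg_mapArcs hm.injective]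
      have h := hE.balance u
      have h1 : relabel S u = 2 * N + 1 ↔ u = 2 * (N - S.card) + 1 := by
        rw [← relabel_last hS, hm.injective.eq_iff]
      have h2 : relabel S u = 0 ↔ u = 0 := by
        conv_lhs => rw [← relabel_zero S]
        exact hm.injective.eq_iff
      simpa only [h1, h2] using h
    · obtain ⟨h1, h2⟩ := deg_mapArcs_of_notMem_range E hv
      rw [h1, h2, if_neg, if_neg]
      · rintro rfl
        exact hv ⟨0, relabel_zero S⟩
      · rintro rfl
        exact hv ⟨_, relabel_last hS⟩

/-! ### Adding a path: the lower bound -/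

/-- The ends `0` and `2 N + 1` and the vertices left free by `relabel S`. -/
def freeVerts (N : ℕ) (S : Finset ℕ) : Finset ℕ :=
  {p ∈ Finset.range (2 * N + 2) | p = 0 ∨ p = 2 * N + 1 ∨ (p - 1) / 2 ∈ S}

theorem mem_freeVerts {N : ℕ} {S : Finset ℕ} {p : ℕ} :
    p ∈ freeVerts N S ↔ p ≤ 2 * N + 1 ∧ (p = 0 ∨ p = 2 * N + 1 ∨ (p - 1) / 2 ∈ S) := by
  simp [freeVerts, Nat.lt_succ_iff]

theorem zero_mem_freeVerts (N : ℕ) (S : Finset ℕ) : 0 ∈ freeVerts N S := by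
  simp [mem_freeVerts]

theorem last_mem_freeVerts (N : ℕ) (S : Finset ℕ) : 2 * N + 1 ∈ freeVerts N S := by
  simp [mem_freeVerts]

theorem odd_mem_freeVerts {N s : ℕ} {S : Finset ℕ} (hS : S ⊆ Finset.range N) (hs : s ∈ S) :
    2 * s + 1 ∈ freeVerts N S := by
  have := Finset.mem_range.1 (hS hs)
  rw [mem_freeVerts, show (2 * s + 1 - 1) / 2 = s by omega]
  exact ⟨by omega, Or.inr (Or.inr hs)⟩

theorem even_mem_freeVerts {N s : ℕ} {S : Finset ℕ} (hS : S ⊆ Finset.range N) :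
    2 * s + 2 ∈ freeVerts N S ↔ s ∈ S := by
  rw [mem_freeVerts, show (2 * s + 2 - 1) / 2 = s by omega]
  constructor
  · rintro ⟨-, h | h | h⟩
    · omega
    · omega
    · exact h
  · intro h
    have := Finset.mem_range.1 (hS h)
    exact ⟨by omega, Or.inr (Or.inr h)⟩

/-- Between the even source and the odd sink, inner free vertices come in adjacent pairs odd, even;
hence parities alternate. -/
theorem consec_freeVerts_parity {N : ℕ} {S : Finset ℕ} (hS : S ⊆ Finset.range N) :
    ∀ e ∈ consec (freeVerts N S), (e.1 + e.2) % 2 = 1 := by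
  rintro ⟨u, v⟩ h
  obtain ⟨hu, hv, huv, hall⟩ := mem_consec.1 h
  have hu' := mem_freeVerts.1 hu
  have hv' := mem_freeVerts.1 hv
  simp only at *
  rcases Nat.mod_two_eq_zero_or_one u with hu2 | hu2
  · by_contra hc
    have hmem : (v - 1) / 2 ∈ S := by
      rcases hv'.2 with h | h | h
      · omega
      · omega
      · exact h
    have := hall _ (odd_mem_freeVerts hS hmem)
    omega
  · have hmem : (u - 1) / 2 ∈ S := by
      rcases hu'.2 with h | h | h
      · omega
      · omega
      · exact h
    have := hall _ ((even_mem_freeVerts hS).2 hmem)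
    omega

theorem isFlow_consec_freeVerts {N : ℕ} {S : Finset ℕ} (hS : S ⊆ Finset.range N) :
    IsFlow (2 * N + 1) 1 (consec (freeVerts N S)) :=
  isFlow_consec (zero_mem_freeVerts N S) (last_mem_freeVerts N S)
    (fun _ hv => (mem_freeVerts.1 hv).1) (consec_freeVerts_parity hS)

theorem eq_of_relabel_mem_freeVerts {N : ℕ} {S : Finset ℕ} {p : ℕ}
    (h : relabel S p ∈ freeVerts N S) : relabel S p = 0 ∨ relabel S p = 2 * N + 1 := by
  rcases (mem_freeVerts.1 h).2 with h | h | h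
  · exact Or.inl h
  · exact Or.inr h
  · by_cases h0 : relabel S p = 0
    · exact Or.inl h0
    · exact absurd h (half_relabel_notMem S h0)

/-- Relabelled arcs meet the free vertices only at the two ends, and the direct arc between the ends
is not on the path once `S` is nonempty. -/
theorem disjoint_mapArcs_consec {N : ℕ} {S : Finset ℕ} (hS : S ⊆ Finset.range N)
    (hne : S.Nonempty) (E : Finset (ℕ × ℕ)) :
    Disjoint (mapArcs (relabel S) E) (consec (freeVerts N S)) := by
  rw [Finset.disjoint_left]
  rintro _ he hc
  obtain ⟨⟨p, q⟩, -, rfl⟩ := Finset.mem_image.1 he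
  obtain ⟨hu, hv, huv, hall⟩ := mem_consec.1 hc
  have h1 := eq_of_relabel_mem_freeVerts hu
  have h2 := eq_of_relabel_mem_freeVerts hv
  obtain ⟨s, hs⟩ := hne
  have h3 := hall _ (odd_mem_freeVerts hS hs)
  have := Finset.mem_range.1 (hS hs)
  omega

/-- The flow of value one more obtained by adding a path through the free vertices. -/
noncomputable def addPath (N : ℕ) (S : Finset ℕ) (E : Finset (ℕ × ℕ)) : Finset (ℕ × ℕ) :=
  mapArcs (relabel S) E ∪ consec (freeVerts N S)

theorem IsFlow.addPath {S : Finset ℕ} {N k : ℕ} (hS : S ⊆ Finset.range N) (hne : S.Nonempty)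
    {E : Finset (ℕ × ℕ)} (hE : IsFlow (2 * (N - S.card) + 1) k E) :
    IsFlow (2 * N + 1) (k + 1) (addPath N S E) :=
  (hE.mapArcs_relabel hS).union (isFlow_consec_freeVerts hS) (disjoint_mapArcs_consec hS hne E)

theorem exists_first_arc (N : ℕ) (S : Finset ℕ) :
    ∃ x, x ≤ 2 * N + 1 ∧ (0, x) ∈ consec (freeVerts N S) := by
  obtain ⟨x, hx⟩ := exists_consec_right (zero_mem_freeVerts N S) (last_mem_freeVerts N S)
    (by omega)
  exact ⟨x, (mem_freeVerts.1 (mem_consec.1 hx).2.1).1, hx⟩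

/-- An arc of `addPath N S E` that leaves an inner free vertex belongs to the added path. -/
theorem mem_freeVerts_of_mem_addPath {N : ℕ} {S : Finset ℕ} {E : Finset (ℕ × ℕ)} {u v : ℕ}
    (hu : u ∈ freeVerts N S) (h0 : u ≠ 0) (hL : u ≠ 2 * N + 1) (h : (u, v) ∈ addPath N S E) :
    v ∈ freeVerts N S := by
  rcases Finset.mem_union.1 h with h | h
  · obtain ⟨⟨p, q⟩, -, he⟩ := Finset.mem_image.1 h
    simp only [Prod.map_apply, Prod.mk.injEq] at he
    rw [← he.1] at hu h0 hL
    exact absurd (eq_of_relabel_mem_freeVerts hu) (by tauto)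
  · exact (mem_consec.1 h).2.1

/-- Several arcs may leave `0`, so the first arc of the path must be given. From then on the path is
forced: arcs leaving an inner free vertex belong to it. -/
theorem freeVerts_eq_of_addPath_eq {N : ℕ} {S T : Finset ℕ} {E F : Finset (ℕ × ℕ)} {x : ℕ}
    (h : addPath N S E = addPath N T F) (hS : (0, x) ∈ consec (freeVerts N S))
    (hT : (0, x) ∈ consec (freeVerts N T)) : freeVerts N S = freeVerts N T := by
  have step : ∀ {S T : Finset ℕ} {E F : Finset (ℕ × ℕ)} {w : ℕ},
      addPath N S E = addPath N T F → (0, x) ∈ consec (freeVerts N S) →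
      (0, x) ∈ consec (freeVerts N T) →
      (∀ u < w, u ∈ freeVerts N S → u ∈ freeVerts N T) →
      w ∈ freeVerts N S → w ∈ freeVerts N T := by
    intro S T E F w h hS hT ih hw
    rcases Nat.eq_zero_or_pos w with rfl | hpos
    · exact zero_mem_freeVerts N T
    obtain ⟨u, hu⟩ := exists_consec_left hw (zero_mem_freeVerts N S) hpos
    obtain ⟨h1, -, h3, -⟩ := mem_consec.1 hu
    by_cases h0 : u = 0
    · subst h0
      rw [consec_right_unique hu hS]
      exact (mem_consec.1 hT).2.1
    · refine mem_freeVerts_of_mem_addPath (ih u h3 h1) h0 ?_ (E := F) ?_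
      · have := (mem_freeVerts.1 hw).1
        omega
      · rw [← h]
        exact Finset.mem_union_right _ hu
  ext w
  induction w using Nat.strong_induction_on with
  | _ w ih =>
    exact ⟨step h hS hT fun u hu => (ih u hu).1, step h.symm hT hS fun u hu => (ih u hu).2⟩

theorem addPath_injective {N : ℕ} {S T : Finset ℕ} {E F : Finset (ℕ × ℕ)} {x : ℕ}
    (hSN : S ⊆ Finset.range N) (hTN : T ⊆ Finset.range N) (hSne : S.Nonempty)
    (h : addPath N S E = addPath N T F) (hS : (0, x) ∈ consec (freeVerts N S))
    (hT : (0, x) ∈ consec (freeVerts N T)) : S = T ∧ E = F := by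
  have hV := freeVerts_eq_of_addPath_eq h hS hT
  obtain rfl : S = T := by
    ext s
    -- The even vertex of a pair is used because the odd vertex `2 N + 1` is always free, although
    -- `N ∉ S`.
    rw [← even_mem_freeVerts hSN, ← even_mem_freeVerts hTN, hV]
  refine ⟨rfl, mapArcs_injective (relabel_strictMono S).injective ?_⟩
  rw [← Finset.union_sdiff_cancel_right (disjoint_mapArcs_consec hSN hSne E),
    ← Finset.union_sdiff_cancel_right (disjoint_mapArcs_consec hSN hSne F)]
  exact congrArg (· \ _) h

/-- The factor `2 * N + 2` pays for the head of the first arc of the added path, the only datum that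
the enlarged flow does not reveal. -/
theorem choose_mul_card_flows_le {N m : ℕ} (hm : 0 < m) (k : ℕ) :
    N.choose m * (flows (2 * (N - m) + 1) k).card ≤
      (2 * N + 2) * (flows (2 * N + 1) (k + 1)).card := by
  choose x hxle hx using exists_first_arc N
  have := Finset.card_le_card_of_injOn
    (s := (Finset.range N).powersetCard m ×ˢ flows (2 * (N - m) + 1) k)
    (t := Finset.range (2 * N + 2) ×ˢ flows (2 * N + 1) (k + 1))
    (fun q => (x q.1, addPath N q.1 q.2)) (by
      rintro ⟨S, E⟩ h
      simp only [Finset.coe_product, Set.mem_prod, Finset.mem_coe, Finset.mem_powersetCard,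
        mem_flows, Finset.mem_range] at h ⊢
      obtain ⟨⟨hS, rfl⟩, hE⟩ := h
      exact ⟨Nat.lt_succ_of_le (hxle S), hE.addPath hS (Finset.card_pos.1 hm)⟩) (by
      rintro ⟨S, E⟩ h ⟨T, F⟩ h' heq
      simp only [Finset.coe_product, Set.mem_prod, Finset.mem_coe, Finset.mem_powersetCard,
        mem_flows, Prod.mk.injEq] at h h' heq ⊢
      exact addPath_injective h.1.1 h'.1.1 (Finset.card_pos.1 (by omega)) heq.2 (hx S)
        (heq.1 ▸ hx T))
  simpa [Finset.card_product, Finset.card_powersetCard] using this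

theorem flows_nonempty {N k : ℕ} (h : k ≤ N + 1) : (flows (2 * N + 1) k).Nonempty := by
  induction N generalizing k with
  | zero =>
    rcases (show k = 0 ∨ k = 1 by omega) with rfl | rfl
    · exact ⟨∅, mem_flows.2 ⟨by simp, by simp [outDeg, inDeg]⟩⟩
    · exact ⟨_, mem_flows.2 (isFlow_consec_freeVerts (N := 0) (S := ∅) (by simp))⟩
  | succ N ih =>
    cases k with
    | zero => exact ⟨∅, mem_flows.2 ⟨by simp, by simp [outDeg, inDeg]⟩⟩
    | succ k =>
      obtain ⟨E, hE⟩ := ih (k := k) (by omega)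
      refine ⟨addPath (N + 1) {0} E, mem_flows.2 (IsFlow.addPath (by simp) (by simp) ?_)⟩
      simpa using mem_flows.1 hE

/-! ### Realizations as flows -/

/-- The pair of classes `a_i`, `b_j` as an arc, where `a_i` is the vertex `2 i` and `b_j` the
vertex `2 j + 1`. -/
def arcOf {n : ℕ} (i j : Fin n) : ℕ × ℕ :=
  if i ≤ j then (2 * (i : ℕ), 2 * (j : ℕ) + 1) else (2 * (j : ℕ) + 1, 2 * (i : ℕ))

theorem arcOf_injective {n : ℕ} :
    Function.Injective fun q : Fin n × Fin n => arcOf q.1 q.2 := by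
  rintro ⟨i, j⟩ ⟨i', j'⟩ h
  simp only [arcOf] at h
  simp only [Prod.mk.injEq, Fin.ext_iff]
  split_ifs at h <;> simp only [Prod.mk.injEq] at h <;> omega

theorem exists_arcOf_eq {n : ℕ} {e : ℕ × ℕ} (h : e.1 < e.2) (h' : e.2 < 2 * n)
    (hpar : (e.1 + e.2) % 2 = 1) : ∃ i j : Fin n, arcOf i j = e := by
  obtain ⟨u, v⟩ := e
  simp only at h h' hpar
  rcases Nat.mod_two_eq_zero_or_one u with hu | hu
  · refine ⟨⟨u / 2, by omega⟩, ⟨v / 2, by omega⟩, ?_⟩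
    rw [arcOf, if_pos (by simp only [Fin.mk_le_mk]; omega)]
    simp only [Prod.mk.injEq]
    omega
  · refine ⟨⟨v / 2, by omega⟩, ⟨u / 2, by omega⟩, ?_⟩
    rw [arcOf, if_neg (by simp only [Fin.mk_le_mk]; omega)]
    simp only [Prod.mk.injEq]
    omega

open Classical in
/-- The arcs of the pairs in which `G` differs from the half graph. -/
noncomputable def diffArcs {n : ℕ} (G : SimpleGraph (Fin n ⊕ Fin n)) : Finset (ℕ × ℕ) :=
  {q : Fin n × Fin n | ¬ (G.Adj (Sum.inl q.1) (Sum.inr q.2) ↔ q.1 ≤ q.2)}.toFinset.image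
    fun q => arcOf q.1 q.2

theorem arcOf_mem_diffArcs {n : ℕ} {G : SimpleGraph (Fin n ⊕ Fin n)} {i j : Fin n} :
    arcOf i j ∈ diffArcs G ↔ ¬ (G.Adj (Sum.inl i) (Sum.inr j) ↔ i ≤ j) := by
  classical
  unfold diffArcs
  rw [Finset.mem_image]
  constructor
  · rintro ⟨q, hq, h⟩
    rw [Set.mem_toFinset] at hq
    rw [show q = (i, j) from arcOf_injective h] at hq
    exact hq
  · intro h
    exact ⟨(i, j), by simpa using h, rfl⟩

theorem mem_diffArcs {n : ℕ} {G : SimpleGraph (Fin n ⊕ Fin n)} {e : ℕ × ℕ} :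
    e ∈ diffArcs G ↔
      ∃ i j, arcOf i j = e ∧ ¬ (G.Adj (Sum.inl i) (Sum.inr j) ↔ i ≤ j) := by
  constructor
  · intro h
    obtain ⟨q, -, rfl⟩ := Finset.mem_image.1 (id h)
    exact ⟨q.1, q.2, rfl, arcOf_mem_diffArcs.1 h⟩
  · rintro ⟨i, j, rfl, h⟩
    exact arcOf_mem_diffArcs.2 h

theorem diffArcs_arc {n : ℕ} (hn : 1 ≤ n) {G : SimpleGraph (Fin n ⊕ Fin n)} :
    ∀ e ∈ diffArcs G, e.1 < e.2 ∧ e.2 ≤ 2 * n - 1 ∧ (e.1 + e.2) % 2 = 1 := by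
  intro e he
  obtain ⟨i, j, rfl, -⟩ := mem_diffArcs.1 he
  unfold arcOf
  split_ifs with h <;> rw [Fin.le_def] at h <;> dsimp only <;> omega

open Classical in
theorem outDeg_diffArcs_even {n : ℕ} (G : SimpleGraph (Fin n ⊕ Fin n)) (i : Fin n) :
    outDeg (diffArcs G) (2 * (i : ℕ)) =
      (Finset.univ.filter fun j : Fin n =>
        i ≤ j ∧ ¬ (G.Adj (Sum.inl i) (Sum.inr j) ↔ i ≤ j)).card := by
  rw [outDeg, ← Finset.card_image_of_injective (f := fun j : Fin n => arcOf i j) _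
    (fun j j' h => (Prod.mk.inj (arcOf_injective (a₁ := (i, j)) (a₂ := (i, j')) h)).2)]
  congr 1
  ext e
  simp only [Finset.mem_filter, Finset.mem_image, Finset.mem_univ, true_and]
  constructor
  · rintro ⟨h, he⟩
    obtain ⟨i', j, rfl, hX⟩ := mem_diffArcs.1 h
    unfold arcOf at he
    split_ifs at he with hle
    · obtain rfl : i' = i := Fin.ext (by dsimp only at he; omega)
      exact ⟨j, ⟨hle, hX⟩, rfl⟩
    · dsimp only at he; omega
  · rintro ⟨j, ⟨hle, hX⟩, rfl⟩
    exact ⟨arcOf_mem_diffArcs.2 hX, by rw [arcOf, if_pos hle]⟩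

open Classical in
theorem inDeg_diffArcs_even {n : ℕ} (G : SimpleGraph (Fin n ⊕ Fin n)) (i : Fin n) :
    inDeg (diffArcs G) (2 * (i : ℕ)) =
      (Finset.univ.filter fun j : Fin n =>
        ¬ i ≤ j ∧ ¬ (G.Adj (Sum.inl i) (Sum.inr j) ↔ i ≤ j)).card := by
  rw [inDeg, ← Finset.card_image_of_injective (f := fun j : Fin n => arcOf i j) _
    (fun j j' h => (Prod.mk.inj (arcOf_injective (a₁ := (i, j)) (a₂ := (i, j')) h)).2)]
  congr 1
  ext e
  simp only [Finset.mem_filter, Finset.mem_image, Finset.mem_univ, true_and]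
  constructor
  · rintro ⟨h, he⟩
    obtain ⟨i', j, rfl, hX⟩ := mem_diffArcs.1 h
    unfold arcOf at he
    split_ifs at he with hle
    · dsimp only at he; omega
    · obtain rfl : i' = i := Fin.ext (by dsimp only at he; omega)
      exact ⟨j, ⟨hle, hX⟩, rfl⟩
  · rintro ⟨j, ⟨hle, hX⟩, rfl⟩
    exact ⟨arcOf_mem_diffArcs.2 hX, by rw [arcOf, if_neg hle]⟩

open Classical in
theorem outDeg_diffArcs_odd {n : ℕ} (G : SimpleGraph (Fin n ⊕ Fin n)) (j : Fin n) :
    outDeg (diffArcs G) (2 * (j : ℕ) + 1) =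
      (Finset.univ.filter fun i : Fin n =>
        ¬ i ≤ j ∧ ¬ (G.Adj (Sum.inl i) (Sum.inr j) ↔ i ≤ j)).card := by
  rw [outDeg, ← Finset.card_image_of_injective (f := fun i : Fin n => arcOf i j) _
    (fun i i' h => (Prod.mk.inj (arcOf_injective (a₁ := (i, j)) (a₂ := (i', j)) h)).1)]
  congr 1
  ext e
  simp only [Finset.mem_filter, Finset.mem_image, Finset.mem_univ, true_and]
  constructor
  · rintro ⟨h, he⟩
    obtain ⟨i, j', rfl, hX⟩ := mem_diffArcs.1 h
    unfold arcOf at he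
    split_ifs at he with hle
    · dsimp only at he; omega
    · obtain rfl : j' = j := Fin.ext (by dsimp only at he; omega)
      exact ⟨i, ⟨hle, hX⟩, rfl⟩
  · rintro ⟨i, ⟨hle, hX⟩, rfl⟩
    exact ⟨arcOf_mem_diffArcs.2 hX, by rw [arcOf, if_neg hle]⟩

open Classical in
theorem inDeg_diffArcs_odd {n : ℕ} (G : SimpleGraph (Fin n ⊕ Fin n)) (j : Fin n) :
    inDeg (diffArcs G) (2 * (j : ℕ) + 1) =
      (Finset.univ.filter fun i : Fin n =>
        i ≤ j ∧ ¬ (G.Adj (Sum.inl i) (Sum.inr j) ↔ i ≤ j)).card := by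
  rw [inDeg, ← Finset.card_image_of_injective (f := fun i : Fin n => arcOf i j) _
    (fun i i' h => (Prod.mk.inj (arcOf_injective (a₁ := (i, j)) (a₂ := (i', j)) h)).1)]
  congr 1
  ext e
  simp only [Finset.mem_filter, Finset.mem_image, Finset.mem_univ, true_and]
  constructor
  · rintro ⟨h, he⟩
    obtain ⟨i, j', rfl, hX⟩ := mem_diffArcs.1 h
    unfold arcOf at he
    split_ifs at he with hle
    · obtain rfl : j' = j := Fin.ext (by dsimp only at he; omega)
      exact ⟨i, ⟨hle, hX⟩, rfl⟩
    · dsimp only at he; omega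
  · rintro ⟨i, ⟨hle, hX⟩, rfl⟩
    exact ⟨arcOf_mem_diffArcs.2 hX, by rw [arcOf, if_pos hle]⟩

open Classical in
/-- Replacing a set by another one loses and gains the two parts of the symmetric difference. -/
theorem card_filter_add_card_filter_and_not_iff {α : Type*} (s : Finset α) (p q : α → Prop) :
    (s.filter p).card + (s.filter fun x => q x ∧ ¬ (p x ↔ q x)).card =
      (s.filter q).card + (s.filter fun x => ¬ q x ∧ ¬ (p x ↔ q x)).card := by
  simp only [Finset.card_filter, ← Finset.sum_add_distrib]
  refine Finset.sum_congr rfl fun x _ => ?_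
  by_cases hp : p x <;> by_cases hq : q x <;> simp [hp, hq]

open Classical in
theorem ncard_neighborSet_inl {n : ℕ} {G : SimpleGraph (Fin n ⊕ Fin n)}
    (hG : G.IsBipartiteWith (Set.range Sum.inl) (Set.range Sum.inr)) (i : Fin n) :
    (G.neighborSet (Sum.inl i)).ncard =
      (Finset.univ.filter fun j : Fin n => G.Adj (Sum.inl i) (Sum.inr j)).card := by
  rw [← Finset.card_image_of_injective _ (Sum.inr_injective (α := Fin n)), ← Set.ncard_coe_finset]
  congr 1
  ext v
  have := @hG.mem_of_adj (Sum.inl i) v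
  cases v <;> simp_all

open Classical in
theorem ncard_neighborSet_inr {n : ℕ} {G : SimpleGraph (Fin n ⊕ Fin n)}
    (hG : G.IsBipartiteWith (Set.range Sum.inl) (Set.range Sum.inr)) (j : Fin n) :
    (G.neighborSet (Sum.inr j)).ncard =
      (Finset.univ.filter fun i : Fin n => G.Adj (Sum.inl i) (Sum.inr j)).card := by
  rw [← Finset.card_image_of_injective _ (Sum.inl_injective (β := Fin n)), ← Set.ncard_coe_finset]
  congr 1
  ext v
  have := @hG.mem_of_adj (Sum.inr j) v
  cases v <;> simp_all [G.adj_comm]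

/-- At `a_i` outgoing arcs are lost edges and incoming arcs gained ones; at `b_j` the roles are
exchanged. -/
theorem ncard_neighborSet_inl_add {n : ℕ} {G : SimpleGraph (Fin n ⊕ Fin n)}
    (hG : G.IsBipartiteWith (Set.range Sum.inl) (Set.range Sum.inr)) (i : Fin n) :
    (G.neighborSet (Sum.inl i)).ncard + outDeg (diffArcs G) (2 * (i : ℕ)) =
      (n - (i : ℕ)) + inDeg (diffArcs G) (2 * (i : ℕ)) := by
  classical
  rw [ncard_neighborSet_inl hG, outDeg_diffArcs_even, inDeg_diffArcs_even]
  have h := card_filter_add_card_filter_and_not_iff Finset.univ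
    (fun j : Fin n => G.Adj (Sum.inl i) (Sum.inr j)) (fun j => i ≤ j)
  have h' : (Finset.univ.filter fun j : Fin n => i ≤ j).card = n - (i : ℕ) := by
    rw [Finset.filter_le_eq_Ici, Fin.card_Ici]
  rw [← h']
  convert h

theorem ncard_neighborSet_inr_add {n : ℕ} {G : SimpleGraph (Fin n ⊕ Fin n)}
    (hG : G.IsBipartiteWith (Set.range Sum.inl) (Set.range Sum.inr)) (j : Fin n) :
    (G.neighborSet (Sum.inr j)).ncard + inDeg (diffArcs G) (2 * (j : ℕ) + 1) =
      ((j : ℕ) + 1) + outDeg (diffArcs G) (2 * (j : ℕ) + 1) := by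
  classical
  rw [ncard_neighborSet_inr hG, outDeg_diffArcs_odd, inDeg_diffArcs_odd]
  have h := card_filter_add_card_filter_and_not_iff Finset.univ
    (fun i : Fin n => G.Adj (Sum.inl i) (Sum.inr j)) (fun i => i ≤ j)
  have h' : (Finset.univ.filter fun i : Fin n => i ≤ j).card = (j : ℕ) + 1 := by
    rw [Finset.filter_ge_eq_Iic, Fin.card_Iic]
  rw [← h']
  convert h

theorem mem_bipRealizations_hDeg_iff {k n : ℕ} (hn : 1 ≤ n) (hk : k ≤ n)
    {G : SimpleGraph (Fin n ⊕ Fin n)}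
    (hG : G.IsBipartiteWith (Set.range Sum.inl) (Set.range Sum.inr)) :
    G ∈ bipRealizations (hDeg k n) ↔ IsFlow (2 * n - 1) k (diffArcs G) := by
  have hin : inDeg (diffArcs G) 0 = 0 := by
    rw [inDeg, Finset.card_eq_zero, Finset.filter_eq_empty_iff]
    intro e he
    have := diffArcs_arc hn e he
    omega
  have hout : ∀ v, 2 * n - 1 ≤ v → outDeg (diffArcs G) v = 0 := by
    intro v hv
    rw [outDeg, Finset.card_eq_zero, Finset.filter_eq_empty_iff]
    intro e he
    have := diffArcs_arc hn e he
    omega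
  constructor
  · rintro ⟨-, hdeg⟩
    refine ⟨diffArcs_arc hn, fun v => ?_⟩
    by_cases hv : v < 2 * n
    · rcases Nat.mod_two_eq_zero_or_one v with h2 | h2
      · obtain ⟨i, rfl⟩ : ∃ i : Fin n, v = 2 * (i : ℕ) :=
          ⟨⟨v / 2, by omega⟩, by simp only; omega⟩
        have h1 := ncard_neighborSet_inl_add hG i
        rw [hdeg] at h1
        simp only [hDeg, halfGraphDeg, Sum.elim_inl] at h1
        have := i.2
        by_cases hi : (i : ℕ) = 0
        · simp only [hi, mul_zero, if_true, hin] at h1 ⊢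
          rw [if_neg (by omega)]
          omega
        · rw [if_neg hi] at h1
          rw [if_neg (by omega), if_neg (by omega)]
          omega
      · obtain ⟨j, rfl⟩ : ∃ j : Fin n, v = 2 * (j : ℕ) + 1 :=
          ⟨⟨v / 2, by omega⟩, by simp only; omega⟩
        have h1 := ncard_neighborSet_inr_add hG j
        rw [hdeg] at h1
        simp only [hDeg, halfGraphDeg, Sum.elim_inr] at h1
        have := j.2
        by_cases hj : (j : ℕ) + 1 = n
        · have := hout (2 * (j : ℕ) + 1) (by omega)
          rw [if_pos hj] at h1
          rw [if_pos (by omega), if_neg (by omega)]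
          omega
        · rw [if_neg hj] at h1
          rw [if_neg (by omega), if_neg (by omega)]
          omega
    -- Beyond the sink there are no arcs, so balance is trivial.
    · rw [hout v (by omega), if_neg (by omega), if_neg (by omega), inDeg, eq_comm,
        add_zero, Finset.card_eq_zero, Finset.filter_eq_empty_iff]
      intro e he
      have := diffArcs_arc hn e he
      omega
  · intro hF
    refine ⟨hG, ?_⟩
    rintro (i | j)
    · have h1 := ncard_neighborSet_inl_add hG i
      have h2 := hF.balance (2 * (i : ℕ))
      simp only [hDeg, halfGraphDeg, Sum.elim_inl]
      have := i.2
      rw [if_neg (by omega)] at h2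
      by_cases hi : (i : ℕ) = 0
      · simp only [hi, mul_zero, if_true, hin] at h1 h2 ⊢
        omega
      · rw [if_neg (by omega)] at h2
        rw [if_neg hi]
        omega
    · have h1 := ncard_neighborSet_inr_add hG j
      have h2 := hF.balance (2 * (j : ℕ) + 1)
      simp only [hDeg, halfGraphDeg, Sum.elim_inr]
      have := j.2
      rw [if_neg (show ¬ 2 * (j : ℕ) + 1 = 0 by omega)] at h2
      by_cases hj : (j : ℕ) + 1 = n
      · have := hout (2 * (j : ℕ) + 1) (by omega)
        rw [if_pos (by omega)] at h2
        rw [if_pos hj]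
        omega
      · rw [if_neg (by omega)] at h2
        rw [if_neg hj]
        omega

/-- The bipartite graph that differs from the half graph in the pairs of the arcs in `E`. -/
def graphOfArcs (n : ℕ) (E : Finset (ℕ × ℕ)) : SimpleGraph (Fin n ⊕ Fin n) where
  Adj
    | Sum.inl i, Sum.inr j => ¬ (arcOf i j ∈ E ↔ i ≤ j)
    | Sum.inr j, Sum.inl i => ¬ (arcOf i j ∈ E ↔ i ≤ j)
    | _, _ => False
  symm := ⟨by rintro (i | i) (j | j) h <;> exact h⟩
  loopless := ⟨by rintro (i | i) h <;> exact h⟩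

theorem graphOfArcs_isBipartiteWith (n : ℕ) (E : Finset (ℕ × ℕ)) :
    (graphOfArcs n E).IsBipartiteWith (Set.range Sum.inl) (Set.range Sum.inr) where
  disjoint := Set.isCompl_range_inl_range_inr.disjoint
  mem_of_adj := by
    rintro (i | i) (j | j) h
    · exact h.elim
    · simp
    · simp
    · exact h.elim

/-- Switching the pairs in `E` relative to the half graph is an involution. -/
theorem diffArcs_graphOfArcs {n : ℕ} {E : Finset (ℕ × ℕ)}
    (hE : ∀ e ∈ E, e.1 < e.2 ∧ e.2 < 2 * n ∧ (e.1 + e.2) % 2 = 1) :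
    diffArcs (graphOfArcs n E) = E := by
  have hiff : ∀ i j : Fin n, arcOf i j ∈ diffArcs (graphOfArcs n E) ↔ arcOf i j ∈ E := by
    intro i j
    rw [arcOf_mem_diffArcs]
    change ¬ (¬ (arcOf i j ∈ E ↔ i ≤ j) ↔ i ≤ j) ↔ _
    tauto
  ext e
  constructor
  · intro h
    obtain ⟨i, j, rfl, -⟩ := mem_diffArcs.1 h
    exact (hiff i j).1 h
  · intro h
    obtain ⟨h1, h2, h3⟩ := hE e h
    obtain ⟨i, j, rfl⟩ := exists_arcOf_eq h1 h2 h3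
    exact (hiff i j).2 h

theorem diffArcs_injOn (n : ℕ) :
    Set.InjOn diffArcs {G : SimpleGraph (Fin n ⊕ Fin n) |
      G.IsBipartiteWith (Set.range Sum.inl) (Set.range Sum.inr)} := by
  intro G hG H hH h
  have key : ∀ i j : Fin n, G.Adj (Sum.inl i) (Sum.inr j) ↔ H.Adj (Sum.inl i) (Sum.inr j) := by
    intro i j
    have h1 := arcOf_mem_diffArcs (G := G) (i := i) (j := j)
    rw [h, arcOf_mem_diffArcs] at h1
    tauto
  have hno : ∀ {K : SimpleGraph (Fin n ⊕ Fin n)},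
      K.IsBipartiteWith (Set.range Sum.inl) (Set.range Sum.inr) → ∀ i j,
      ¬ K.Adj (Sum.inl i) (Sum.inl j) ∧ ¬ K.Adj (Sum.inr i) (Sum.inr j) := by
    intro K hK i j
    constructor <;> intro hadj <;> simpa using hK.mem_of_adj hadj
  ext u v
  rcases u with i | i <;> rcases v with j | j
  · exact iff_of_false (hno hG i j).1 (hno hH i j).1
  · exact key i j
  · rw [G.adj_comm, H.adj_comm]
    exact key j i
  · exact iff_of_false (hno hG i j).2 (hno hH i j).2

theorem ncard_bipRealizations_hDeg {k n : ℕ} (hn : 1 ≤ n) (hk : k ≤ n) :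
    (bipRealizations (hDeg k n)).ncard = (flows (2 * n - 1) k).card := by
  have himage : diffArcs '' bipRealizations (hDeg k n) = ↑(flows (2 * n - 1) k) := by
    ext E
    rw [Finset.mem_coe, mem_flows]
    constructor
    · rintro ⟨G, hG, rfl⟩
      exact (mem_bipRealizations_hDeg_iff hn hk hG.1).1 hG
    · intro hE
      have hd : diffArcs (graphOfArcs n E) = E := by
        refine diffArcs_graphOfArcs fun e he => ?_
        have := hE.arc e he
        omega
      refine ⟨graphOfArcs n E, ?_, hd⟩
      rw [mem_bipRealizations_hDeg_iff hn hk (graphOfArcs_isBipartiteWith n E), hd]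
      exact hE
  rw [← Set.ncard_coe_finset, ← himage,
    ((diffArcs_injOn n).mono fun G hG => hG.1).ncard_image]

/-! ### Growth rates and conclusion -/

theorem Polynomial.exists_eval_le_mul_pow (p : Polynomial ℝ) :
    ∃ C d : ℕ, ∀ x : ℝ, 1 ≤ x → p.eval x ≤ C * x ^ d := by
  obtain ⟨C, hC⟩ := exists_nat_ge (∑ i ∈ Finset.range (p.natDegree + 1), |p.coeff i|)
  refine ⟨C, p.natDegree, fun x hx => ?_⟩
  rw [Polynomial.eval_eq_sum_range]
  calc ∑ i ∈ Finset.range (p.natDegree + 1), p.coeff i * x ^ i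
      ≤ ∑ i ∈ Finset.range (p.natDegree + 1), |p.coeff i| * x ^ p.natDegree := by
        refine Finset.sum_le_sum fun i hi => ?_
        have hi' : i ≤ p.natDegree := Nat.lt_succ_iff.1 (Finset.mem_range.1 hi)
        exact mul_le_mul (le_abs_self _) (pow_le_pow_right₀ hx hi') (by positivity) (abs_nonneg _)
    _ = (∑ i ∈ Finset.range (p.natDegree + 1), |p.coeff i|) * x ^ p.natDegree := by
        rw [Finset.sum_mul]
    _ ≤ C * x ^ p.natDegree := by gcongr

/-- A sequence of positive numbers with at most exponential growth does not grow by arbitrarily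
large factors over steps of bounded length. -/
theorem exists_lt_mul_of_le_pow {f : ℕ → ℕ} {A : ℕ} (hf : ∀ N, f N ≤ A ^ (N + 1)) (m N₀ : ℕ)
    (hpos : 0 < f N₀) : ∃ N, N₀ ≤ N ∧ f (N + m) < 2 * A ^ m * f N := by
  by_contra! h
  have hgrow : ∀ t, (2 * A ^ m) ^ t ≤ f (N₀ + m * t) := by
    intro t
    induction t with
    | zero => simpa using Nat.succ_le_of_lt hpos
    | succ t ih =>
      calc (2 * A ^ m) ^ (t + 1) = 2 * A ^ m * (2 * A ^ m) ^ t := by ring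
        _ ≤ 2 * A ^ m * f (N₀ + m * t) := by gcongr
        _ ≤ f (N₀ + m * t + m) := h _ (by omega)
        _ = _ := by rw [mul_add_one, add_assoc]
  have hA : 0 < A := by
    rcases Nat.eq_zero_or_pos A with rfl | hA
    · simpa using hpos.trans_le (hf N₀)
    · exact hA
  -- After `t = A ^ (N₀ + 1)` steps the growth would give `2 ^ t * A ^ (m * t) ≤ t * A ^ (m * t)`.
  have h1 := (hgrow (A ^ (N₀ + 1))).trans (hf _)
  set t := A ^ (N₀ + 1) with ht
  have h2 : A ^ (N₀ + m * t + 1) = t * A ^ (m * t) := by rw [ht]; ring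
  rw [h2, mul_pow, ← pow_mul] at h1
  have h3 := Nat.le_of_mul_le_mul_right h1 (by positivity)
  exact absurd Nat.lt_two_pow_self (not_lt.2 h3)

/-- The number of flows of value `k + 1` is not polynomially bounded by that of value `k`. -/
theorem exists_mul_card_flows_lt (k C d : ℕ) :
    ∃ N, k ≤ N ∧ C * (2 * N + 2) ^ d * (flows (2 * N + 1) k).card <
      (flows (2 * N + 1) (k + 1)).card := by
  by_contra! h
  set f : ℕ → ℕ := fun N => (flows (2 * N + 1) k).card with hf
  -- The binomial coefficient has order `N ^ (d + 2)`; the assumed bound and the factor `2 * N + 2`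
  -- use up `d + 1` powers, leaving one.
  obtain ⟨m, hm⟩ : ∃ m, m = d + 2 := ⟨_, rfl⟩
  have hle : ∀ N, f N ≤ (4 ^ k) ^ (N + 1) := by
    intro N
    refine (card_flows_le (by omega) k).trans_eq ?_
    rw [show 2 * N + 1 + 1 = 2 * (N + 1) by ring, pow_mul 2 2]
    norm_num [← pow_mul, mul_comm]
  set M := m.factorial * C * 4 ^ (d + 1) with hM
  have hstep : ∀ N, k ≤ N → m ≤ N → (N + 1) * f N ≤ M * f (N + m) := by
    intro N hkN hmN
    have h1 := choose_mul_card_flows_le (N := N + m) (m := m) (by omega) k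
    rw [Nat.add_sub_cancel] at h1
    have h2 := h (N + m) (by omega)
    have h3 := Nat.pow_sub_le_descFactorial (N + m) m
    rw [Nat.descFactorial_eq_factorial_mul_choose, show N + m + 1 - m = N + 1 by omega] at h3
    have h4 : (N + 1) ^ (d + 1) * ((N + 1) * f N) ≤ (N + 1) ^ (d + 1) * (M * f (N + m)) := by
      calc (N + 1) ^ (d + 1) * ((N + 1) * f N) = (N + 1) ^ m * f N := by rw [hm]; ring
        _ ≤ m.factorial * (N + m).choose m * f N := by gcongr
        _ = m.factorial * ((N + m).choose m * f N) := by ring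
        _ ≤ m.factorial * ((2 * (N + m) + 2) *
            (C * (2 * (N + m) + 2) ^ d * f (N + m))) := by
          exact Nat.mul_le_mul_left _ (h1.trans (Nat.mul_le_mul_left _ h2))
        _ = m.factorial * C * (2 * (N + m) + 2) ^ (d + 1) * f (N + m) := by ring
        _ ≤ m.factorial * C * (4 * (N + 1)) ^ (d + 1) * f (N + m) := by
          gcongr
          omega
        _ = _ := by rw [hM, mul_pow]; ring
    exact Nat.le_of_mul_le_mul_left h4 (by positivity)
  have hpos : ∀ N, k ≤ N → 0 < f N := fun N hN =>
    Finset.card_pos.2 (flows_nonempty (by omega))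
  -- The last summand of the threshold makes the linear factor from `hstep` beat the constant growth
  -- factor at `N`.
  obtain ⟨N, hN, hlt⟩ := exists_lt_mul_of_le_pow hle m (k + m + 2 * (4 ^ k) ^ m * M)
    (hpos _ (by omega))
  have h1 := hstep N (by omega) (by omega)
  have h2 : M * f (N + m) ≤ M * (2 * (4 ^ k) ^ m * f N) := by gcongr
  have h3 : M * (2 * (4 ^ k) ^ m * f N) = 2 * (4 ^ k) ^ m * M * f N := by ring
  have h4 : 2 * (4 ^ k) ^ m * M * f N ≤ N * f N := Nat.mul_le_mul_right _ (by omega)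
  have h5 := hpos N (by omega)
  rw [add_mul] at h1
  omega

/-- Only `a_1` and `b_n` change, each by at most one, even where the subtraction truncates. -/
theorem sum_abs_hDeg_succ_sub_le (k n : ℕ) :
    ∑ v, |(hDeg (k + 1) n v : ℤ) - (hDeg k n v : ℤ)| ≤ 2 := by
  have hone : ∀ P : Fin n → Prop, ∀ [DecidablePred P], (∀ i j, P i → P j → i = j) →
      ∑ i, (if P i then (1 : ℤ) else 0) ≤ 1 := by
    intro P _ hP
    rw [Finset.sum_boole]
    exact_mod_cast Finset.card_le_one.2 fun i hi j hj => hP i j (by simpa using hi)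
      (by simpa using hj)
  have h1 := hone (fun i => (i : ℕ) = 0) fun i j hi hj => Fin.ext (hi.trans hj.symm)
  have h2 := hone (fun j => (j : ℕ) + 1 = n) fun i j hi hj => Fin.ext (by omega)
  have habs : ∀ (P : Prop) [Decidable P] (x : ℕ),
      |((x - (if P then k + 1 else 0) : ℕ) : ℤ) - ((x - (if P then k else 0) : ℕ) : ℤ)| ≤
        if P then 1 else 0 := by
    intro P _ x
    split_ifs
    · rw [abs_le]; omega
    · simp
  rw [Fintype.sum_sum_type]
  refine (add_le_add ((Finset.sum_le_sum fun i _ => ?_).trans h1)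
    ((Finset.sum_le_sum fun j _ => ?_).trans h2)).trans_eq (by norm_num)
  · exact habs _ _
  · exact habs _ _

theorem mainTheorem2 (k : ℕ) :
    (∀ d ∈ hClass k, d.IsGraphic) ∧ ¬ IsPStable (hClass k) := by
  constructor
  · rintro _ ⟨n, hn, hk, rfl⟩
    refine Set.nonempty_of_ncard_ne_zero ?_
    change (bipRealizations (hDeg k n)).ncard ≠ 0
    rw [ncard_bipRealizations_hDeg hn hk, show 2 * n - 1 = 2 * (n - 1) + 1 by omega]
    exact (Finset.card_pos.2 (flows_nonempty (by omega))).ne'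
  · rintro ⟨p, hp⟩
    obtain ⟨C, d, hCd⟩ := p.exists_eval_le_mul_pow
    obtain ⟨N, hN, hlt⟩ := exists_mul_card_flows_lt k C d
    -- With `n = N + 1` the sink is `2 * N + 1`, there are `2 * N + 2` vertices, and `k ≤ N` gives
    -- `k + 1 ≤ n`.
    have h := hp (hSeq k (N + 1)) ⟨N + 1, by omega, by omega, rfl⟩ (hDeg (k + 1) (N + 1))
      (sum_abs_hDeg_succ_sub_le k (N + 1))
    dsimp only at h
    rw [ncard_bipRealizations_hDeg (by omega) (by omega),
      ncard_bipRealizations_hDeg (by omega) (by omega),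
      show 2 * (N + 1) - 1 = 2 * N + 1 by omega] at h
    have h1 := hCd ((N + 1 + (N + 1) : ℕ) : ℝ) (by norm_cast; omega)
    have h2 := h.trans (mul_le_mul_of_nonneg_right h1 (Nat.cast_nonneg _))
    rw [show N + 1 + (N + 1) = 2 * N + 2 by ring] at h2
    exact absurd hlt (not_lt.2 (by exact_mod_cast h2))
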